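/- Let $L=L_1\cup\dots\cup L_n$ be an oriented (smooth) link in $S^3$ with integer multiplicities $\underline m=(m_1,\dots,m_n)$ on its components (a multilink $L(\underline m)$), and let $X$ be its exterior, the complement in $S^3$ of an open tubular neighbourhood of $L$. The multiplicities determine a homotopy class of maps $X\to S^1$: those with degree $m_i$ on the positively oriented meridian of $L_i$, for all $i$. For any map $\phi_0$ in this class let $\widetilde X=\{(x,r)\in X\times\mathbb R : \phi_0(x)=e^{2\pi i r}\}$ be the corresponding infinite cyclic covering; the Alexander module of $L(\underline m)$ is $A=H_1(\widetilde X;\mathbb Z)$, a $\mathbb Z[t^{\pm1}]$-module where $t$ acts by the map induced by $(x,r)\mapsto(x,r+1)$. A $k\times l$ presentation matrix of $A$ is the matrix $P$ of a presentation with $l$ generators (columns) and $k$ relations (rows), and the Alexander polynomial of $L(\underline m)$ is the greatest common divisor of the $l\times l$ minors of any such $P$, up to multiplication by units of $\mathbb Z[t^{\pm1}]$. Suppose that $L(\underline m)$ is fibered, that is, that there is a locally trivial fibration $\varphi\colon X\to S^1$ in the homotopy class $\underline m$. Let $F=\varphi^{-1}(1)$. Then $\varphi$ has a monodromy: a homeomorphism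 $h\colon F\to F$ for which there is a homeomorphism $F\times\mathbb R\to\{(x,r)\in X\times\mathbb R : \varphi(x)=e^{2\pi i r}\}$ over $\mathbb R$, equal to $x\mapsto(x,0)$ on $F\times\{0\}$, conjugating $(x,r)\mapsto(x,r+1)$ to $(x,z)\mapsto(h(x),z+1)$. For every monodromy $h$ and every matrix $H$ of $h_*\colon H_1(F;\mathbb Z)\to H_1(F;\mathbb Z)$ with respect to a finite $\mathbb Z$-basis of $H_1(F;\mathbb Z)$, the matrix $H^T-tI$ is a presentation matrix of the Alexander module $A$ of $L(\underline m)$. In particular, the Alexander polynomial of $L(\underline m)$ is the characteristic polynomial $\det(tI-H)$ of the monodromy, up to multiplication by units. -/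

import Mathlib

open scoped ContDiff LaurentPolynomial

noncomputable section

/-! ### Oriented links, multilinks and their exteriors -/

/-- The 3-sphere, as the unit sphere of `ℝ⁴`. -/
abbrev S3 : Type := Metric.sphere (0 : EuclideanSpace ℝ (Fin 4)) 1

/-- An oriented link with `n` components in `S³`: disjoint smooth embeddings of the circle, the
orientation of each component being the one of its parametrization. -/
structure OrientedLink (n : ℕ) where
  comp : Fin n → Circle → S3
  smooth : ∀ i, ContDiff ℝ ∞
    (fun s : ℝ => (comp i (Circle.exp s) : EuclideanSpace ℝ (Fin 4)))
  immersion : ∀ i (s : ℝ),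
    deriv (fun s : ℝ => (comp i (Circle.exp s) : EuclideanSpace ℝ (Fin 4))) s ≠ 0
  injective : Function.Injective (fun p : Fin n × Circle => comp p.1 p.2)

/-- A multilink: an oriented link with an integer multiplicity on each component. -/
structure Multilink (n : ℕ) extends OrientedLink n where
  mult : Fin n → ℤ

/-- The map `ℝ × ℂ → ℝ⁴`, `(s, w) ↦ T (e^{is}, w)` underlying `T : S¹ × ℂ → S³`. -/
def liftTube (T : Circle × ℂ → S3) (p : ℝ × ℂ) : EuclideanSpace ℝ (Fin 4) :=
  (T (Circle.exp p.1, p.2) : EuclideanSpace ℝ (Fin 4))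

/-- A tubular neighbourhood of an oriented link: disjoint smooth, orientation preserving open
embeddings of `S¹ × ℂ` in `S³` that restrict to the components of the link on `S¹ × {0}`.
`S³` is oriented as the boundary of the unit ball (outward normal first), so that the frame
`∂/∂s, ∂/∂x, ∂/∂y` is sent to a positive frame of `S³` exactly if the determinant is positive. -/
structure TubularNeighborhood {n : ℕ} (L : OrientedLink n) where
  tube : Fin n → Circle × ℂ → S3
  core : ∀ i z, tube i (z, 0) = L.comp i z
  isOpenEmbedding : ∀ i, Topology.IsOpenEmbedding (tube i)
  disjoint : Pairwise fun i j => Disjoint (Set.range (tube i)) (Set.range (tube j))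
  smooth : ∀ i, ContDiff ℝ ∞ (liftTube (tube i))
  orientation : ∀ i (p : ℝ × ℂ),
    0 < Matrix.det (Matrix.of ![
      (fun k => liftTube (tube i) p k),
      (fun k => fderiv ℝ (liftTube (tube i)) p (1, 0) k),
      (fun k => fderiv ℝ (liftTube (tube i)) p (0, 1) k),
      (fun k => fderiv ℝ (liftTube (tube i)) p (0, Complex.I) k)] : Matrix (Fin 4) (Fin 4) ℝ)

namespace TubularNeighborhood

variable {n : ℕ} {L : OrientedLink n} (N : TubularNeighborhood L)

/-- The exterior of the link: the complement in `S³` of the open tubes of radius one. -/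
def exterior : Set S3 :=
  (⋃ i, N.tube i '' (Set.univ ×ˢ Metric.ball (0 : ℂ) 1))ᶜ

lemma tube_mem_exterior (i : Fin n) (z : Circle) (w : ℂ) (hw : ‖w‖ = 1) :
    N.tube i (z, w) ∈ N.exterior := by
  simp only [exterior, Set.mem_compl_iff, Set.mem_iUnion, not_exists]
  rintro j ⟨⟨z', w'⟩, ⟨-, hw'⟩, h⟩
  rcases eq_or_ne j i with rfl | hji
  · have := (N.isOpenEmbedding j).injective h
    simp only [Prod.mk.injEq] at this
    simp [this.2, hw] at hw'
  · exact Set.disjoint_left.1 (N.disjoint hji) ⟨_, h⟩ ⟨_, rfl⟩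

/-- The positively oriented meridian of the `i`-th component, on the boundary of the exterior. -/
def meridian (i : Fin n) : C(Circle, N.exterior) where
  toFun w := ⟨N.tube i (1, (w : ℂ)), N.tube_mem_exterior i 1 w w.norm_coe⟩
  continuous_toFun := by
    refine Continuous.subtype_mk ((N.isOpenEmbedding i).continuous.comp ?_) _
    fun_prop

end TubularNeighborhood

/-- The map `z ↦ z ^ k` from the circle to itself. -/
def circlePow (k : ℤ) : C(Circle, Circle) := ⟨fun z => z ^ k, continuous_zpow k⟩

/-- The homotopy class of maps `X → S¹` given by multiplicities `m`, where `X` is the exterior: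
the maps whose degree on the meridian of the `i`-th component is `m i` for every `i`. -/
def homotopyClass {n : ℕ} {L : OrientedLink n} (N : TubularNeighborhood L) (m : Fin n → ℤ) :
    Set C(N.exterior, Circle) :=
  {φ | ∀ i, (φ.comp (N.meridian i)).Homotopic (circlePow (m i))}

/-! ### The infinite cyclic covering, fibrations and their monodromy -/

section Covering

variable {X : Type} [TopologicalSpace X]

/-- The pullback along `φ` of the covering `ℝ → S¹`, `r ↦ exp (2πir)`. -/
def CyclicCover (φ : C(X, Circle)) : Type :=
  {p : X × ℝ // φ p.1 = Circle.exp (2 * Real.pi * p.2)}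

instance (φ : C(X, Circle)) : TopologicalSpace (CyclicCover φ) :=
  inferInstanceAs (TopologicalSpace {p : X × ℝ // φ p.1 = Circle.exp (2 * Real.pi * p.2)})

/-- The generator `(x, r) ↦ (x, r + 1)` of the group of the covering. -/
def deckGenerator (φ : C(X, Circle)) : CyclicCover φ ≃ₜ CyclicCover φ where
  toFun p := ⟨(p.1.1, p.1.2 + 1), by rw [p.2, mul_add, mul_one, Circle.exp_add_two_pi]⟩
  invFun p := ⟨(p.1.1, p.1.2 - 1), by rw [p.2, mul_sub, mul_one, Circle.exp_sub_two_pi]⟩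
  left_inv p := by apply Subtype.ext; simp
  right_inv p := by apply Subtype.ext; simp
  continuous_toFun := by
    refine Continuous.subtype_mk ?_ _
    have : Continuous (fun p : CyclicCover φ => p.1) := continuous_subtype_val
    fun_prop
  continuous_invFun := by
    refine Continuous.subtype_mk ?_ _
    have : Continuous (fun p : CyclicCover φ => p.1) := continuous_subtype_val
    fun_prop

/-- The map is a locally trivial fibration. -/
def IsLocallyTrivialFibration (φ : C(X, Circle)) : Prop :=
  ∃ (G : Type) (_ : TopologicalSpace G), ∀ b : Circle,
    ∃ e : Bundle.Trivialization G (φ : X → Circle), b ∈ e.baseSet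

/-- The fiber `φ⁻¹(1)`. -/
abbrev fiber (φ : C(X, Circle)) : Type := {x : X // φ x = 1}

/-- The inclusion of the fiber in the covering at height zero. -/
def fiberInclusion (φ : C(X, Circle)) (x : fiber φ) : CyclicCover φ :=
  ⟨(x.1, 0), by simp [x.2]⟩

/-- `h` is a monodromy of `φ`: there is a homeomorphism from `F × ℝ` to the infinite cyclic
covering, over `ℝ` and equal to the inclusion on `F × {0}`, which conjugates the generator of the
group of the covering to `(x, z) ↦ (h x, z + 1)`. -/
def IsMonodromy (φ : C(X, Circle)) (h : fiber φ ≃ₜ fiber φ) : Prop :=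
  ∃ Ψ : fiber φ × ℝ ≃ₜ CyclicCover φ,
    (∀ x z, (Ψ (x, z)).1.2 = z) ∧
    (∀ x, Ψ (x, 0) = fiberInclusion φ x) ∧
    ∀ x z, deckGenerator φ (Ψ (x, z)) = Ψ (h x, z + 1)

end Covering

/-! ### Homology -/

/-- The first singular homology functor with integer coefficients. -/
abbrev H1Functor : CategoryTheory.Functor TopCat.{0} (ModuleCat.{0} ℤ) :=
  (AlgebraicTopology.singularHomologyFunctor (ModuleCat.{0} ℤ) 1).obj (ModuleCat.of ℤ ℤ)

/-- The first singular homology group of `X` with integer coefficients. -/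
abbrev H1 (X : Type) [TopologicalSpace X] : Type := H1Functor.obj (TopCat.of X)

/-- The automorphism of `H₁(X)` induced by a homeomorphism from `X` to itself. -/
def H1.aut {X : Type} [TopologicalSpace X] (h : X ≃ₜ X) : H1 X ≃ₗ[ℤ] H1 X :=
  (H1Functor.mapIso (TopCat.isoOfHomeo h)).toLinearEquiv

/-! ### Modules over `ℤ[t, t⁻¹]` -/

section Laurent

variable {M : Type} [AddCommGroup M] [Module ℤ M]

/-- The ring homomorphism `ℤ[t, t⁻¹] → End M` sending `t` to a given automorphism of `M`. -/
def laurentToEnd (e : M ≃ₗ[ℤ] M) : ℤ[T;T⁻¹] →+* Module.End ℤ M :=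
  (AddMonoidAlgebra.lift ℤ (Module.End ℤ M) ℤ ((Units.coeHom (Module.End ℤ M)).comp
    (zpowersHom _ (LinearMap.GeneralLinearGroup.ofLinearEquiv e)))).toRingHom

/-- The abelian group `M`, as a `ℤ[t, t⁻¹]`-module on which `t` acts as `e`. -/
def LaurentModule (_e : M ≃ₗ[ℤ] M) : Type := M

instance (e : M ≃ₗ[ℤ] M) : AddCommGroup (LaurentModule e) := inferInstanceAs (AddCommGroup M)

instance (e : M ≃ₗ[ℤ] M) : Module ℤ[T;T⁻¹] (LaurentModule e) :=
  Module.compHom M (laurentToEnd e)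

theorem LaurentModule.T_smul (e : M ≃ₗ[ℤ] M) (x : M) :
    (LaurentPolynomial.T 1 : ℤ[T;T⁻¹]) • (show LaurentModule e from x) = e x := by
  change laurentToEnd e (LaurentPolynomial.T 1) x = e x
  have h := AddMonoidAlgebra.lift_single (R := ℤ) (A := Module.End ℤ M)
    ((Units.coeHom (Module.End ℤ M)).comp
      (zpowersHom _ (LinearMap.GeneralLinearGroup.ofLinearEquiv e))) (1 : ℤ) (1 : ℤ)
  refine (congrArg (fun g : Module.End ℤ M => g x) h).trans ?_
  rw [one_smul]
  simp

end Laurent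

/-- The Alexander module `H₁` of the infinite cyclic covering defined by `φ`, where `t` acts by the
generator `(x, r) ↦ (x, r + 1)`. The Alexander module of a multilink is obtained from any `φ` in the
homotopy class of maps on the exterior given by the multiplicities. -/
abbrev AlexanderModule {X : Type} [TopologicalSpace X] (φ : C(X, Circle)) : Type :=
  LaurentModule (H1.aut (deckGenerator φ))

/-- `P` is a presentation matrix of `A`, with one row for each of the `k` relations and one column
for each of the `l` generators: there is an exact sequence `Rᵏ → Rˡ → A → 0` whose first map sends
the `i`-th basis vector to the `i`-th row of `P`. -/
def IsPresentationMatrix {R : Type} [CommRing R] {k l : ℕ} (P : Matrix (Fin k) (Fin l) R)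
    (A : Type) [AddCommGroup A] [Module R A] : Prop :=
  ∃ f : (Fin l → R) →ₗ[R] A, Function.Exact P.vecMulLinear f ∧ Function.Surjective f

/-- `Δ` is a greatest common divisor of the `l × l` minors of the `k × l` matrix `P`. -/
def IsGCDOfMinors {R : Type} [CommRing R] {k l : ℕ} (P : Matrix (Fin k) (Fin l) R) (Δ : R) :
    Prop :=
  ∀ x : R, x ∣ Δ ↔ ∀ r : Fin l ↪o Fin k, x ∣ (P.submatrix r id).det

/-- `Δ` is the Alexander polynomial (up to units) of a `ℤ[t, t⁻¹]`-module `A`: `A` has a finite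
presentation, and `Δ` is a greatest common divisor of the maximal minors of every presentation
matrix, of size the number of generators. -/
def IsAlexanderPolynomial (A : Type) [AddCommGroup A] [Module ℤ[T;T⁻¹] A] (Δ : ℤ[T;T⁻¹]) : Prop :=
  (∃ (k l : ℕ) (P : Matrix (Fin k) (Fin l) ℤ[T;T⁻¹]), IsPresentationMatrix P A) ∧
  ∀ (k l : ℕ) (P : Matrix (Fin k) (Fin l) ℤ[T;T⁻¹]), IsPresentationMatrix P A → IsGCDOfMinors P Δ

end

/-! A monodromy `h` gives a product structure `F × ℝ` on the infinite cyclic covering of `φ`, so the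
inclusion of `F` is a homotopy equivalence under which the deck generator corresponds to `h`. Hence
the Alexander module of `φ` is `H₁(F)` with `t` acting as `h_*`
(`IsMonodromy.nonempty_linearEquiv`). When `H₁(F)` is free with finite basis `b`, the generators `b`
and the relations `h_*(b j) = t • b j` present this module, which is the matrix `Hᵀ - tI`
(`isPresentationMatrix_transpose_sub_T`).

Three further points are needed. The module must not depend on the map chosen in the class `m`: the
quotient of two such maps is null-homotopic on every meridian, hence extends over the solid tori to
`S³`, where it lifts to `ℝ`; the lift is a shift of heights that identifies the two coverings
(`exists_lift_of_mem_homotopyClass`, `nonempty_alexanderModule_equiv`). No computation of the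
cohomology of the exterior is used.

The gcd of maximal minors must not depend on the presentation: the initial Fitting ideal depends
only on the module and here is generated by the determinant of a square presentation
(`fittingIdeal_eq`, `fittingIdeal_eq_span_det`).

A monodromy must exist: the covering, a bundle over `ℝ`, is trivial over `[0, 1]`, and deck
translates of this product glue to one over all of `ℝ` (`exists_isMonodromy_of_trivialization`). -/

noncomputable section

/-! ### The initial Fitting ideal -/

section Fitting

variable {R : Type*} [CommRing R] {A : Type*} [AddCommGroup A] [Module R A]

/-- The ideal generated by the determinants of the square matrices whose rows are relations
between the generators given by `f`. -/
def fittingIdeal {l : ℕ} (f : (Fin l → R) →ₗ[R] A) : Ideal R :=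
  Ideal.span {d | ∃ N : Matrix (Fin l) (Fin l) R, (∀ i, f (N i) = 0) ∧ N.det = d}

lemma det_mem_fittingIdeal {l : ℕ} {f : (Fin l → R) →ₗ[R] A} {N : Matrix (Fin l) (Fin l) R}
    (hN : ∀ i, f (N i) = 0) : N.det ∈ fittingIdeal f :=
  Ideal.subset_span ⟨N, hN, rfl⟩

/-- Expansion along the last columns: only the first columns need to consist of relations. -/
lemma det_mem_fittingIdeal_of_castAdd {l : ℕ} {f : (Fin l → R) →ₗ[R] A} :
    ∀ (n : ℕ) (M : Matrix (Fin (l + n)) (Fin (l + n)) R),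
      (∀ i, f (fun j => M i (Fin.castAdd n j)) = 0) → M.det ∈ fittingIdeal f
  | 0, _, hM => det_mem_fittingIdeal hM
  | n + 1, M, hM => by
    have := Matrix.det_succ_column (n := l + n) M (Fin.last _)
    rw [this]
    refine Ideal.sum_mem _ fun i _ => Ideal.mul_mem_left _ _ ?_
    refine det_mem_fittingIdeal_of_castAdd n _ fun k => ?_
    simp only [Matrix.submatrix_apply, Fin.succAbove_last]
    exact hM _

/-- Write each system of generators in terms of the other, by matrices `C` and `D`, and enlarge `N`
to the block matrix with rows `(1 - DC, -D)` and `(NC, N)`. It has the determinant of `N`, and its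
first `m` columns consist of relations for `g`, so expansion along the remaining columns applies. -/
lemma fittingIdeal_le {l m : ℕ} {f : (Fin l → R) →ₗ[R] A} {g : (Fin m → R) →ₗ[R] A}
    (hf : Function.Surjective f) (hg : Function.Surjective g) :
    fittingIdeal f ≤ fittingIdeal g := by
  rw [fittingIdeal, Ideal.span_le]
  rintro _ ⟨N, hN, rfl⟩
  choose C hC using fun j : Fin l => hg (f (Pi.single j 1))
  choose D hD using fun j : Fin m => hf (g (Pi.single j 1))
  let C' : Matrix (Fin l) (Fin m) R := C
  let D' : Matrix (Fin m) (Fin l) R := D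
  have hgC : ∀ v : Fin l → R, g (Matrix.vecMul v C') = f v := by
    intro v
    have : g ∘ₗ C'.vecMulLinear = f := by
      refine LinearMap.pi_ext' fun j => LinearMap.ext_ring ?_
      simpa using (congrArg g (Matrix.single_one_vecMul j C')).trans (hC j)
    exact congrArg (fun k : (Fin l → R) →ₗ[R] A => k v) this
  let M : Matrix (Fin m ⊕ Fin l) (Fin m ⊕ Fin l) R :=
    Matrix.fromBlocks 1 (-D') 0 N * Matrix.fromBlocks 1 0 C' 1
  have hM : M = Matrix.fromBlocks (1 - D' * C') (-D') (N * C') N := by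
    simp [M, Matrix.fromBlocks_multiply, sub_eq_add_neg]
  have hdet : M.det = N.det := by
    simp [M, Matrix.det_mul, Matrix.det_fromBlocks_zero₂₁]
  have hmem := det_mem_fittingIdeal_of_castAdd (f := g) l
    (M.reindex finSumFinEquiv finSumFinEquiv) ?_
  · rwa [Matrix.det_reindex_self, hdet] at hmem
  · intro i
    obtain ⟨i, rfl⟩ := finSumFinEquiv.surjective i
    simp only [hM, Matrix.reindex_apply, Matrix.submatrix_apply, Equiv.symm_apply_apply,
      finSumFinEquiv_symm_apply_castAdd]
    rcases i with i | i
    · have : (fun j => Matrix.fromBlocks (1 - D' * C') (-D') (N * C') N (Sum.inl i) (Sum.inl j)) =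
          Pi.single i 1 - Matrix.vecMul (D' i) C' := by
        ext j
        simp [Matrix.one_apply, Pi.single_apply, Matrix.mul_apply, Matrix.vecMul, dotProduct,
          eq_comm]
      rw [this, map_sub, hgC, sub_eq_zero]
      exact (hD i).symm
    · have : (fun j => Matrix.fromBlocks (1 - D' * C') (-D') (N * C') N (Sum.inr i) (Sum.inl j)) =
          Matrix.vecMul (N i) C' := by
        ext j
        simp [Matrix.mul_apply, Matrix.vecMul, dotProduct]
      rw [this, hgC, hN]

lemma fittingIdeal_eq {l m : ℕ} {f : (Fin l → R) →ₗ[R] A} {g : (Fin m → R) →ₗ[R] A}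
    (hf : Function.Surjective f) (hg : Function.Surjective g) :
    fittingIdeal f = fittingIdeal g :=
  (fittingIdeal_le hf hg).antisymm (fittingIdeal_le hg hf)

lemma exists_eq_mul_of_exact {k l : ℕ} {P : Matrix (Fin k) (Fin l) R} {f : (Fin l → R) →ₗ[R] A}
    (hP : Function.Exact P.vecMulLinear f) {N : Matrix (Fin l) (Fin l) R}
    (hN : ∀ i, f (N i) = 0) : ∃ V : Matrix (Fin l) (Fin k) R, N = V * P := by
  choose V hV using fun i => (hP (N i)).1 (hN i)
  exact ⟨V, by ext i j; exact (congrFun (hV i) j).symm⟩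

lemma map_row_eq_zero {k l : ℕ} {P : Matrix (Fin k) (Fin l) R} {f : (Fin l → R) →ₗ[R] A}
    (hP : Function.Exact P.vecMulLinear f) (i : Fin k) : f (P i) = 0 :=
  (hP (P i)).2 ⟨Pi.single i 1, by simp [Matrix.row]⟩

/-- Every matrix of relations is `V * Q`, so its determinant is a multiple of `Q.det`; the rows of
`Q` are themselves relations. -/
lemma fittingIdeal_eq_span_det {l : ℕ} {Q : Matrix (Fin l) (Fin l) R} {f : (Fin l → R) →ₗ[R] A}
    (hQ : Function.Exact Q.vecMulLinear f) : fittingIdeal f = Ideal.span {Q.det} := by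
  apply le_antisymm
  · rw [fittingIdeal, Ideal.span_le]
    rintro _ ⟨N, hN, rfl⟩
    obtain ⟨V, rfl⟩ := exists_eq_mul_of_exact hQ hN
    rw [Matrix.det_mul]
    exact Ideal.mul_mem_left _ _ (Ideal.mem_span_singleton_self _)
  · rw [Ideal.span_singleton_le_iff_mem]
    exact det_mem_fittingIdeal (map_row_eq_zero hQ)

/-- A common divisor of the maximal minors of `P` divides `det (V * P)` for every `V`. -/
lemma dvd_det_mul_of_dvd_minors {k l : ℕ} {P : Matrix (Fin k) (Fin l) R} {x : R}
    (hx : ∀ r : Fin l ↪o Fin k, x ∣ (P.submatrix r id).det) (V : Matrix (Fin l) (Fin k) R) :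
    x ∣ (V * P).det := by
  -- Arbitrary row selections reduce to increasing ones: sorting changes the determinant by a sign,
  -- and a repeated row makes it zero.
  have hall : ∀ r : Fin l → Fin k, x ∣ (P.submatrix r id).det := by
    intro r
    by_cases hr : Function.Injective r
    · let s : Fin l ↪o Fin k := OrderEmbedding.ofStrictMono (r ∘ Tuple.sort r)
        ((Tuple.monotone_sort r).strictMono_of_injective (hr.comp (Tuple.sort r).injective))
      have h1 := hx s
      have h2 : P.submatrix s id = (P.submatrix r id).submatrix (Tuple.sort r) id := rfl
      rw [h2, Matrix.det_permute] at h1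
      rcases Int.units_eq_one_or (Equiv.Perm.sign (Tuple.sort r)) with h | h <;>
        simpa [h] using h1
    · obtain ⟨i, j, hij, hne⟩ : ∃ i j, r i = r j ∧ i ≠ j := by
        simpa [Function.Injective] using hr
      rw [Matrix.det_zero_of_row_eq hne (by ext; simp [hij])]
      exact dvd_zero x
  -- Cauchy–Binet before terms are grouped: the rows of `V * P` are combinations of rows of `P`, and
  -- the determinant is multilinear in rows.
  have hsum : (V * P).det = ∑ r : Fin l → Fin k, (∏ i, V i (r i)) * (P.submatrix r id).det := by
    have h1 : (V * P : Matrix (Fin l) (Fin l) R) = fun i => ∑ j, V i j • P j := by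
      ext i c
      simp [Matrix.mul_apply]
    have h2 := (Matrix.detRowAlternating (n := Fin l) (R := R)).toMultilinearMap.map_sum
      (fun i (j : Fin k) => V i j • P j)
    have h3 : ∀ r : Fin l → Fin k,
        (Matrix.detRowAlternating (n := Fin l) (R := R)).toMultilinearMap
          (fun i => V i (r i) • P (r i)) = (∏ i, V i (r i)) * (P.submatrix r id).det := fun r =>
      (Matrix.detRowAlternating (n := Fin l) (R := R)).toMultilinearMap.map_smul_univ _ _
    rw [h1]
    exact h2.trans (Finset.sum_congr rfl fun r _ => h3 r)
  rw [hsum]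
  exact Finset.dvd_sum fun r _ => (hall r).mul_left _

end Fitting

/-- The minors lie in the Fitting ideal, so `Δ` divides them. Conversely a common divisor of the
minors divides every `det (V * P)`, hence the whole ideal. Only principality of this ideal is
needed, not a gcd structure on `R`. -/
lemma isGCDOfMinors_of_fittingIdeal_eq {R : Type} [CommRing R] {A : Type} [AddCommGroup A]
    [Module R A] {k l : ℕ} {P : Matrix (Fin k) (Fin l) R} {f : (Fin l → R) →ₗ[R] A}
    (hP : Function.Exact P.vecMulLinear f) {Δ : R} (hΔ : fittingIdeal f = Ideal.span {Δ}) :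
    IsGCDOfMinors P Δ := by
  intro x
  constructor
  · intro hx r
    have h : (P.submatrix r id).det ∈ fittingIdeal f :=
      det_mem_fittingIdeal fun i => map_row_eq_zero hP (r i)
    rw [hΔ, Ideal.mem_span_singleton] at h
    exact hx.trans h
  · intro hx
    have h : fittingIdeal f ≤ Ideal.span {x} := by
      rw [fittingIdeal, Ideal.span_le]
      rintro _ ⟨N, hN, rfl⟩
      obtain ⟨V, rfl⟩ := exists_eq_mul_of_exact hP hN
      exact Ideal.mem_span_singleton.2 (dvd_det_mul_of_dvd_minors hx V)
    rw [hΔ, Ideal.span_singleton_le_iff_mem, Ideal.mem_span_singleton] at h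
    exact h

/-- A module with a square presentation matrix has its determinant as Alexander polynomial. -/
lemma IsPresentationMatrix.isAlexanderPolynomial {A : Type} [AddCommGroup A]
    [Module ℤ[T;T⁻¹] A] {l : ℕ} {Q : Matrix (Fin l) (Fin l) ℤ[T;T⁻¹]}
    (hQ : IsPresentationMatrix Q A) {Δ : ℤ[T;T⁻¹]} (hΔ : Associated Q.det Δ) :
    IsAlexanderPolynomial A Δ := by
  refine ⟨⟨l, l, Q, hQ⟩, fun k m P ⟨f, hf, hfs⟩ => ?_⟩
  obtain ⟨g, hg, hgs⟩ := hQ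
  refine isGCDOfMinors_of_fittingIdeal_eq hf ?_
  rw [fittingIdeal_eq hfs hgs, fittingIdeal_eq_span_det hg,
    Ideal.span_singleton_eq_span_singleton.2 hΔ]

lemma IsPresentationMatrix.congr {R : Type} [CommRing R] {k l : ℕ} {P : Matrix (Fin k) (Fin l) R}
    {A B : Type} [AddCommGroup A] [Module R A] [AddCommGroup B] [Module R B]
    (hP : IsPresentationMatrix P A) (e : A ≃ₗ[R] B) : IsPresentationMatrix P B := by
  obtain ⟨f, hf, hfs⟩ := hP
  refine ⟨e.toLinearMap ∘ₗ f, fun x => ?_, e.surjective.comp hfs⟩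
  rw [← hf x]
  simp

/-! ### Modules over `ℤ[t, t⁻¹]` given by an automorphism -/

section Laurent

/-- Constants are integers, which any additive map respects; commuting with `T 1` forces commuting
with its inverse `T (-1)`, and these generate the ring. -/
lemma LaurentPolynomial.map_smul_of_map_T_smul {A B : Type*} [AddCommGroup A] [Module ℤ[T;T⁻¹] A]
    [AddCommGroup B] [Module ℤ[T;T⁻¹] B] (σ : A →+ B)
    (hσ : ∀ x, σ ((T 1 : ℤ[T;T⁻¹]) • x) = (T 1 : ℤ[T;T⁻¹]) • σ x) (p : ℤ[T;T⁻¹]) (x : A) :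
    σ (p • x) = p • σ x := by
  have hinv : ∀ x, σ ((T (-1) : ℤ[T;T⁻¹]) • x) = (T (-1) : ℤ[T;T⁻¹]) • σ x := by
    intro x
    have h := hσ ((T (-1) : ℤ[T;T⁻¹]) • x)
    rw [smul_smul, ← T_add, add_neg_cancel, T_zero, one_smul] at h
    rw [h, smul_smul, ← T_add, neg_add_cancel, T_zero, one_smul]
  induction p using LaurentPolynomial.induction_on generalizing x with
  | h_C a =>
    have : (C a : ℤ[T;T⁻¹]) = (a : ℤ[T;T⁻¹]) := by simp
    rw [this, Int.cast_smul_eq_zsmul, Int.cast_smul_eq_zsmul, map_zsmul]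
  | h_add hp hq => rw [add_smul, add_smul, map_add, hp, hq]
  | h_C_mul_T n a h =>
    rw [T_add, ← mul_assoc, mul_smul, h, hσ, mul_smul _ (T 1)]
  | h_C_mul_T_Z n a h =>
    rw [sub_eq_add_neg, T_add, ← mul_assoc, mul_smul, h, hinv, mul_smul _ (T (-1))]

variable {M M' : Type} [AddCommGroup M] [Module ℤ M] [AddCommGroup M'] [Module ℤ M']

/-- An isomorphism that intertwines two automorphisms is `ℤ[t, t⁻¹]`-linear. -/
def LaurentModule.congr {e : M ≃ₗ[ℤ] M} {e' : M' ≃ₗ[ℤ] M'} (ε : M ≃ₗ[ℤ] M')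
    (h : ∀ x, ε (e x) = e' (ε x)) : LaurentModule e ≃ₗ[ℤ[T;T⁻¹]] LaurentModule e' :=
  let ε' : LaurentModule e ≃+ LaurentModule e' := ε.toAddEquiv
  { ε' with
    map_smul' := fun p x => LaurentPolynomial.map_smul_of_map_T_smul ε'.toAddMonoidHom
      (fun x => (congrArg ε (LaurentModule.T_smul e x)).trans
        ((h x).trans (LaurentModule.T_smul e' (ε x)).symm)) p x }

/-- If `H` is the matrix of the action of `t` on a free abelian group of finite rank, then
`Hᵀ - tI` presents the corresponding `ℤ[t, t⁻¹]`-module. -/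
theorem isPresentationMatrix_transpose_sub_T {μ : ℕ} (b : Module.Basis (Fin μ) ℤ M)
    (e : M ≃ₗ[ℤ] M) :
    IsPresentationMatrix
      ((LinearMap.toMatrix b b e.toLinearMap).transpose.map
          (LaurentPolynomial.C : ℤ →+* LaurentPolynomial ℤ)
        - (LaurentPolynomial.T 1 : LaurentPolynomial ℤ) • 1)
      (LaurentModule e) := by
  set H := LinearMap.toMatrix b b e.toLinearMap with hH
  set Q : Matrix (Fin μ) (Fin μ) ℤ[T;T⁻¹] :=
    H.transpose.map (LaurentPolynomial.C : ℤ →+* LaurentPolynomial ℤ)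
      - (LaurentPolynomial.T 1 : LaurentPolynomial ℤ) • 1 with hQ
  let v : Fin μ → LaurentModule e := b
  let f := Fintype.linearCombination ℤ[T;T⁻¹] v
  have hC : ∀ (a : ℤ) (x : LaurentModule e), (LaurentPolynomial.C a : ℤ[T;T⁻¹]) • x = a • x := by
    intro a x
    have : (LaurentPolynomial.C a : ℤ[T;T⁻¹]) = (a : ℤ[T;T⁻¹]) := by simp
    rw [this, Int.cast_smul_eq_zsmul]
  have hsum : ∀ x : M, (∑ i, b.repr x i • v i : LaurentModule e) = x := fun x => by
    refine Eq.trans (Finset.sum_congr rfl fun i _ => ?_) (b.sum_repr x)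
    exact (int_smul_eq_zsmul _ (b.repr x i) (b i)).symm
  refine ⟨f, ?_, fun x => ⟨fun i => LaurentPolynomial.C (b.repr x i), ?_⟩⟩
  · have hfQ : ∀ j, f (Q j) = 0 := by
      intro j
      have h1 : f (Q j) = ∑ i, (LaurentPolynomial.C (H i j) : ℤ[T;T⁻¹]) • v i
          - (LaurentPolynomial.T 1 : ℤ[T;T⁻¹]) • v j := by
        simp [f, Fintype.linearCombination_apply, hQ, sub_smul, Matrix.one_apply]
      have h2 : ∑ i, (LaurentPolynomial.C (H i j) : ℤ[T;T⁻¹]) • v i = e (b j) := by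
        simp only [hC, hH, LinearMap.toMatrix_apply]
        exact hsum (e (b j))
      rw [h1]
      exact sub_eq_zero.2 (h2.trans (LaurentModule.T_smul e (b j)).symm)
    -- The kernel of `f` lies in the row span `S` because `f` has an inverse modulo `S`: `σ` takes
    -- integer coordinates as constant polynomials. It commutes with `t` since `c (e x) - t • c x`
    -- equals `c x` times `Q`, so `σ ∘ f` is linear, and it agrees with the quotient map on basis
    -- vectors.
    let S : Submodule ℤ[T;T⁻¹] (Fin μ → ℤ[T;T⁻¹]) := LinearMap.range Q.vecMulLinear
    let c : LaurentModule e → Fin μ → ℤ[T;T⁻¹] := fun x i => LaurentPolynomial.C (b.repr x i)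
    let σ : LaurentModule e →+ (Fin μ → ℤ[T;T⁻¹]) ⧸ S :=
      AddMonoidHom.mk' (fun x => S.mkQ (c x)) fun x y => by
        rw [← map_add]
        congr 1
        ext1 i
        refine Eq.trans ?_ (map_add LaurentPolynomial.C (b.repr x i) (b.repr y i))
        exact congrArg LaurentPolynomial.C (congrFun (congrArg _ (map_add b.repr x y)) i)
    have hσ : ∀ x, σ ((LaurentPolynomial.T 1 : ℤ[T;T⁻¹]) • x) =
        (LaurentPolynomial.T 1 : ℤ[T;T⁻¹]) • σ x := by
      intro x
      change S.mkQ _ = _ • S.mkQ _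
      rw [← map_smul, ← sub_eq_zero, ← map_sub, Submodule.mkQ_apply, Submodule.Quotient.mk_eq_zero,
        LaurentModule.T_smul e x]
      refine ⟨c x, ?_⟩
      ext1 j
      have h3 : ∀ x : M, b.repr (e x) j = ∑ i, b.repr x i * H j i := by
        intro x
        rw [← LinearEquiv.coe_coe e, ← LinearMap.toMatrix_mulVec_repr b b]
        simp [Matrix.mulVec, dotProduct, mul_comm, hH]
      have h5 : c (e x) j = ∑ i, c x i * LaurentPolynomial.C (H j i) := by
        refine (congrArg LaurentPolynomial.C (h3 x)).trans ?_
        simp only [map_sum, map_mul]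
        rfl
      rw [Pi.sub_apply, Pi.smul_apply, h5]
      simp only [Matrix.vecMulLinear_apply, Matrix.vecMul, dotProduct, hQ, Matrix.sub_apply,
        Matrix.map_apply, Matrix.transpose_apply, mul_sub, Finset.sum_sub_distrib]
      congr 1
      rw [Finset.sum_eq_single j (fun i _ hi => by simp [hi]) (by simp)]
      rw [Matrix.smul_apply, Matrix.one_apply_eq, smul_eq_mul, smul_eq_mul, mul_one, mul_comm]
    have hσf : ∀ x, σ (f x) = S.mkQ x := by
      let σ' : LaurentModule e →ₗ[ℤ[T;T⁻¹]] (Fin μ → ℤ[T;T⁻¹]) ⧸ S :=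
        { σ with map_smul' := LaurentPolynomial.map_smul_of_map_T_smul σ hσ }
      have : σ' ∘ₗ f = S.mkQ := by
        refine LinearMap.pi_ext' fun j => LinearMap.ext_ring ?_
        have h4 : f (Pi.single j 1) = v j := by simp [f]
        change σ (f (Pi.single j 1)) = S.mkQ (Pi.single j 1)
        rw [h4]
        change S.mkQ (c (b j)) = _
        congr 1
        ext1 i
        by_cases hij : i = j
        · subst hij; simp [c]
        · simp [c, hij]
      exact fun x => congrArg (fun k : _ →ₗ[ℤ[T;T⁻¹]] _ => k x) this
    intro x
    constructor
    · intro hx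
      have := hσf x
      rw [hx, map_zero] at this
      exact (Submodule.Quotient.mk_eq_zero S).1 this.symm
    · rintro ⟨y, rfl⟩
      have : f ∘ₗ Q.vecMulLinear = 0 := by
        refine LinearMap.pi_ext' fun j => LinearMap.ext_ring ?_
        simpa using (congrArg f (Matrix.single_one_vecMul j Q)).trans (hfQ j)
      exact congrArg (fun k : _ →ₗ[ℤ[T;T⁻¹]] _ => k y) this
  · simp only [f, Fintype.linearCombination_apply, hC]
    exact hsum x

/-- The determinant of `Hᵀ - tI` is the characteristic polynomial of `H` up to sign. -/
lemma associated_det_charpoly {μ : ℕ} (H : Matrix (Fin μ) (Fin μ) ℤ) :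
    Associated (H.transpose.map (LaurentPolynomial.C : ℤ →+* LaurentPolynomial ℤ)
        - (LaurentPolynomial.T 1 : LaurentPolynomial ℤ) • 1).det
      (Polynomial.toLaurent H.charpoly) := by
  have h : (H.transpose.map (LaurentPolynomial.C : ℤ →+* LaurentPolynomial ℤ)
      - (LaurentPolynomial.T 1 : LaurentPolynomial ℤ) • 1) =
      -(Polynomial.toLaurent (R := ℤ)).mapMatrix H.charmatrix.transpose := by
    ext i j : 1
    by_cases hij : i = j
    · subst hij
      simp
    · simp [hij, Ne.symm hij]
  rw [h, Matrix.det_neg, ← RingHom.map_det, Matrix.det_transpose]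
  exact associated_unit_mul_left _ _ ((IsUnit.neg isUnit_one).pow _)

end Laurent


/-! ### First homology and homotopies -/

section Homology

variable {X Y Z : Type} [TopologicalSpace X] [TopologicalSpace Y] [TopologicalSpace Z]

/-- The homomorphism induced by a continuous map on the first homology group. -/
def H1.map (f : C(X, Y)) : H1 X →ₗ[ℤ] H1 Y := (H1Functor.map (TopCat.ofHom f)).hom

lemma H1.map_id : H1.map (ContinuousMap.id X) = LinearMap.id := by
  rw [H1.map, TopCat.ofHom_id, CategoryTheory.Functor.map_id]
  rfl

lemma H1.map_comp (g : C(Y, Z)) (f : C(X, Y)) : H1.map (g.comp f) = H1.map g ∘ₗ H1.map f := by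
  rw [H1.map, TopCat.ofHom_comp, CategoryTheory.Functor.map_comp]
  rfl

lemma H1.map_eq_of_homotopic {f g : C(X, Y)} (h : f.Homotopic g) : H1.map f = H1.map g := by
  obtain ⟨H⟩ := h
  have := TopCat.Homotopy.congr_homologyMap_singularChainComplexFunctor
    (f := TopCat.ofHom f) (g := TopCat.ofHom g) H (ModuleCat.of ℤ ℤ) 1
  exact congrArg ModuleCat.Hom.hom this

lemma H1.aut_apply (h : X ≃ₜ X) (x : H1 X) : H1.aut h x = H1.map (h : C(X, X)) x := rfl

/-- The isomorphism of first homology groups induced by a homotopy equivalence. -/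
def H1.congr (f : C(X, Y)) (g : C(Y, X)) (hgf : (g.comp f).Homotopic (ContinuousMap.id X))
    (hfg : (f.comp g).Homotopic (ContinuousMap.id Y)) : H1 X ≃ₗ[ℤ] H1 Y :=
  LinearEquiv.ofLinearMap (H1.map f) (H1.map g)
    (by rw [← H1.map_comp, H1.map_eq_of_homotopic hfg, H1.map_id])
    (by rw [← H1.map_comp, H1.map_eq_of_homotopic hgf, H1.map_id])

/-- A homotopy equivalence that intertwines two homeomorphisms up to homotopy gives an isomorphism
of `ℤ[t, t⁻¹]`-modules. -/
def H1.laurentCongr (a : X ≃ₜ X) (b : Y ≃ₜ Y) (f : C(X, Y)) (g : C(Y, X))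
    (hgf : (g.comp f).Homotopic (ContinuousMap.id X))
    (hfg : (f.comp g).Homotopic (ContinuousMap.id Y))
    (hab : (f.comp (a : C(X, X))).Homotopic ((b : C(Y, Y)).comp f)) :
    LaurentModule (H1.aut a) ≃ₗ[ℤ[T;T⁻¹]] LaurentModule (H1.aut b) :=
  LaurentModule.congr (H1.congr f g hgf hfg) fun x => by
    have := H1.map_eq_of_homotopic hab
    rw [H1.map_comp, H1.map_comp] at this
    exact congrArg (fun k : H1 X →ₗ[ℤ] H1 Y => k x) this

end Homology

/-! ### Comparing Alexander modules through their coverings -/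

section Covering

variable {X : Type} [TopologicalSpace X]

/-- The fiber inclusion identifies the homology of the fiber, with the action of a monodromy, with
the Alexander module. -/
lemma IsMonodromy.nonempty_linearEquiv {φ : C(X, Circle)} {h : fiber φ ≃ₜ fiber φ}
    (hh : IsMonodromy φ h) :
    Nonempty (LaurentModule (H1.aut h) ≃ₗ[ℤ[T;T⁻¹]] AlexanderModule φ) := by
  obtain ⟨Ψ, -, -, hΨ⟩ := hh
  let f : C(fiber φ, CyclicCover φ) := ⟨fun x => Ψ (x, 0), by fun_prop⟩
  let g : C(CyclicCover φ, fiber φ) := ⟨fun y => (Ψ.symm y).1, by fun_prop⟩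
  refine ⟨H1.laurentCongr h (deckGenerator φ) f g ?_ ?_ ?_⟩
  · have : g.comp f = ContinuousMap.id _ := by ext1 x; simp [f, g]
    rw [this]
  -- Scaling the `ℝ`-coordinate contracts `F × ℝ` onto `F × {0}`.
  · refine ⟨⟨⟨fun p => Ψ ((Ψ.symm p.2).1, p.1 * (Ψ.symm p.2).2), by fun_prop⟩, ?_, ?_⟩⟩
    · intro x; simp [f, g]
    · intro x; simp
  -- The deck generator sends `Ψ (x, 0)` to `Ψ (h x, 1)`, which slides down to `Ψ (h x, 0)`.
  · refine ⟨⟨⟨fun p => Ψ (h p.2, p.1), by fun_prop⟩, ?_, ?_⟩⟩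
    · intro x; simp [f]
    · intro x; simp [f, hΨ]

/-- If two maps to the circle differ by a map that lifts to `ℝ`, then their Alexander modules are
isomorphic. -/
lemma nonempty_alexanderModule_equiv {φ φ₀ : C(X, Circle)} (f : C(X, ℝ))
    (hf : ∀ x, φ x = φ₀ x * Circle.exp (f x)) :
    Nonempty (AlexanderModule φ ≃ₗ[ℤ[T;T⁻¹]] AlexanderModule φ₀) := by
  have hval : ∀ ψ : C(X, Circle), Continuous (fun p : CyclicCover ψ => p.1) :=
    fun ψ => continuous_subtype_val
  have h1 := hval φ
  have h2 := hval φ₀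
  have ha : ∀ p : CyclicCover φ,
      φ₀ p.1.1 = Circle.exp (2 * Real.pi * (p.1.2 - f p.1.1 / (2 * Real.pi))) := fun p => by
    rw [mul_sub, mul_div_cancel₀ _ (by positivity), Circle.exp_sub, ← p.2, hf,
      mul_div_cancel_right]
  have hb : ∀ p : CyclicCover φ₀,
      φ p.1.1 = Circle.exp (2 * Real.pi * (p.1.2 + f p.1.1 / (2 * Real.pi))) := fun p => by
    rw [mul_add, mul_div_cancel₀ _ (by positivity), Circle.exp_add, ← p.2, hf]
  -- Shifting heights by `f / 2π` is an isomorphism of coverings that commutes with the deck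
  -- generators on the nose.
  let a : C(CyclicCover φ, CyclicCover φ₀) :=
    ⟨fun p => ⟨(p.1.1, p.1.2 - f p.1.1 / (2 * Real.pi)), ha p⟩,
      Continuous.subtype_mk (by fun_prop) ha⟩
  let b : C(CyclicCover φ₀, CyclicCover φ) :=
    ⟨fun p => ⟨(p.1.1, p.1.2 + f p.1.1 / (2 * Real.pi)), hb p⟩,
      Continuous.subtype_mk (by fun_prop) hb⟩
  refine ⟨H1.laurentCongr (deckGenerator φ) (deckGenerator φ₀) a b ?_ ?_ ?_⟩
  · have : b.comp a = ContinuousMap.id _ := by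
      ext1 p
      exact Subtype.ext (Prod.ext rfl (sub_add_cancel _ _))
    rw [this]
  · have : a.comp b = ContinuousMap.id _ := by
      ext1 p
      exact Subtype.ext (Prod.ext rfl (add_sub_cancel_right _ _))
    rw [this]
  · have : a.comp (deckGenerator φ : C(CyclicCover φ, CyclicCover φ)) =
        (deckGenerator φ₀ : C(CyclicCover φ₀, CyclicCover φ₀)).comp a := by
      ext1 p
      exact Subtype.ext (Prod.ext rfl (add_sub_right_comm _ _ _))
    rw [this]

end Covering


/-! ### Maps to the circle that lift to the line -/

section Lifting

/-- A map to the circle that is homotopic to a constant lifts to `ℝ`. -/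
lemma exists_lift_of_homotopic_one {A : Type*} [TopologicalSpace A] {f : C(A, Circle)}
    (h : f.Homotopic 1) : ∃ F : C(A, ℝ), ∀ a, f a = Circle.exp (F a) := by
  obtain ⟨H⟩ := h.symm
  have hH : ∀ a, H (0, a) = Circle.exp ((0 : C(A, ℝ)) a) := by simp
  let G := Circle.isCoveringMap_exp.liftHomotopy H.toContinuousMap 0 hH
  refine ⟨⟨fun a => G (1, a), by fun_prop⟩, fun a => ?_⟩
  have := congrFun (Circle.isCoveringMap_exp.liftHomotopy_lifts H.toContinuousMap 0 hH) (1, a)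
  exact ((H.apply_one a).symm.trans this.symm)

/-- The quotient map from the cylinder to the torus. -/
def cylinderToTorus : C(unitInterval × Circle, Circle × Circle) :=
  ⟨fun p => (Circle.exp (2 * Real.pi * p.1), p.2), by fun_prop⟩

lemma isQuotientMap_cylinderToTorus : Topology.IsQuotientMap cylinderToTorus := by
  refine cylinderToTorus.continuous.isClosedMap.isQuotientMap cylinderToTorus.continuous ?_
  rintro ⟨z, w⟩
  obtain ⟨s, rfl⟩ := Circle.isAddQuotientCoveringMap_exp.surjective z
  refine ⟨(⟨Int.fract (s / (2 * Real.pi)), Int.fract_nonneg _, (Int.fract_lt_one _).le⟩, w), ?_⟩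
  refine Prod.ext ?_ rfl
  refine Circle.exp_eq_exp.2 ⟨-⌊s / (2 * Real.pi)⌋, ?_⟩
  simp only [Int.fract]
  push_cast
  field_simp
  ring

/-- A map from the torus to the circle that is null-homotopic on `{1} × S¹` factors, up to a map
that lifts to `ℝ`, through the first projection. -/
lemma exists_lift_torus (g : C(Circle × Circle, Circle)) (a : C(Circle, ℝ))
    (ha : ∀ w, g (1, w) = Circle.exp (a w)) :
    ∃ b : C(Circle × Circle, ℝ), ∀ z w, g (z, w) = g (z, 1) * Circle.exp (b (z, w)) := by
  -- Dividing by `g (z, 1)` removes the degree in the `z` direction, which would otherwise make the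
  -- lift differ at the two ends of the cylinder by a multiple of `2π`.
  let H : C(unitInterval × Circle, Circle) :=
    ⟨fun p => g (cylinderToTorus p) / g ((cylinderToTorus p).1, 1), by fun_prop⟩
  let a' : C(Circle, ℝ) := ⟨fun w => a w - a 1, by fun_prop⟩
  have hc0 : ∀ w, cylinderToTorus (0, w) = (1, w) := fun w => by simp [cylinderToTorus]
  have hc1 : ∀ w, cylinderToTorus (1, w) = (1, w) := fun w => by simp [cylinderToTorus]
  have hH : ∀ w, H (0, w) = Circle.exp (a' w) := fun w => by
    simp [H, a', hc0, ha, Circle.exp_sub]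
  have hcov := Circle.isCoveringMap_exp
  let U := hcov.liftHomotopy H a' hH
  have hU : ∀ p, Circle.exp (U p) = H p := congrFun (hcov.liftHomotopy_lifts H a' hH)
  have hU0 : ∀ w, U (0, w) = a' w := hcov.liftHomotopy_zero H a' hH
  have hside : (fun t : unitInterval => U (t, 1)) = fun _ => 0 := by
    refine hcov.eq_of_comp_eq (by fun_prop) continuous_const ?_ 0 (by simp [hU0, a'])
    ext1 t
    simp [hU, H, cylinderToTorus]
  -- Both ends lift the same map, and both vanish at `w = 1` because the lift is zero along that
  -- side; hence they coincide and `U` descends to the torus.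
  have htop : (fun w => U (1, w)) = a' := by
    refine hcov.eq_of_comp_eq (by fun_prop) a'.continuous ?_ 1
      ((congrFun hside 1).trans (by simp [a']))
    ext1 w
    simp only [Function.comp_apply]
    rw [hU, ← hH]
    simp [H, hc0, hc1]
  have hfac : Function.FactorsThrough U cylinderToTorus := by
    have key : ∀ (s t : unitInterval) (w : Circle), (s : ℝ) < t →
        Circle.exp (2 * Real.pi * s) = Circle.exp (2 * Real.pi * t) → U (s, w) = U (t, w) := by
      intro s t w hst hexp
      obtain ⟨m, hm⟩ := Circle.exp_eq_exp.1 hexp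
      have hm' : (s : ℝ) = t + m := by
        have hpi := Real.pi_pos
        apply mul_left_cancel₀ (show (2 * Real.pi) ≠ 0 by positivity)
        rw [hm]; ring
      have h1 : (-2 : ℝ) < m := by linarith [s.2.1, t.2.2]
      have h2 : (m : ℝ) < 0 := by linarith
      have h3 : m = -1 := by
        have h1' : -2 < m := by exact_mod_cast h1
        have h2' : m < 0 := by exact_mod_cast h2
        omega
      subst h3
      push_cast at hm'
      have hs : s = 0 := Subtype.ext (by
        have h4 := s.2.1
        have h5 := t.2.2
        change (s : ℝ) = 0
        linarith)
      have ht : t = 1 := Subtype.ext (by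
        have h4 := s.2.1
        have h5 := t.2.2
        change (t : ℝ) = 1
        linarith)
      subst hs ht
      rw [hU0, ← htop]
    rintro ⟨s, w⟩ ⟨t, w'⟩ h
    obtain ⟨h, rfl⟩ := Prod.ext_iff.1 h
    rcases lt_trichotomy (s : ℝ) t with hst | hst | hst
    · exact key s t w hst h
    · rw [Subtype.ext hst]; rfl
    · exact (key t s w hst h.symm).symm
  let b := isQuotientMap_cylinderToTorus.lift U hfac
  have hb : ∀ p, b (cylinderToTorus p) = U p := fun p =>
    congrArg (fun k : C(_, ℝ) => k p) (isQuotientMap_cylinderToTorus.lift_comp U hfac)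
  refine ⟨b, fun z w => ?_⟩
  obtain ⟨p, hp⟩ := isQuotientMap_cylinderToTorus.surjective (z, w)
  rw [← hp, hb, hU]
  simp [H, hp]

/-- Every map from the 3-sphere to the circle lifts to `ℝ`. -/
lemma exists_lift_S3 (ψ : C(S3, Circle)) : ∃ f : C(S3, ℝ), ∀ x, ψ x = Circle.exp (f x) := by
  have hcov := Circle.isCoveringMap_exp
  -- Stereographic projection makes the complement of `v` a Euclidean space, over which maps to the
  -- circle lift.
  have hlift : ∀ v : S3, ∃ f : S3 → ℝ, ContinuousOn f {v}ᶜ ∧ ∀ x ≠ v, ψ x = Circle.exp (f x) := by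
    intro v
    have hv : ‖(v : EuclideanSpace ℝ (Fin 4))‖ = 1 := norm_eq_of_mem_sphere v
    let e := stereographic hv
    have hsrc : e.source = {v}ᶜ := stereographic_source hv
    have htgt : e.target = Set.univ := stereographic_target hv
    have hcont : Continuous e.symm := by
      rw [← continuousOn_univ, ← htgt]
      exact e.continuousOn_symm
    obtain ⟨s, hs⟩ := Circle.isAddQuotientCoveringMap_exp.surjective (ψ (e.symm 0))
    obtain ⟨F, ⟨-, hF⟩, -⟩ := hcov.existsUnique_continuousMap_lifts
      (ψ.comp ⟨e.symm, hcont⟩) 0 s hs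
    refine ⟨fun x => F (e x), F.continuous.comp_continuousOn (hsrc ▸ e.continuousOn), ?_⟩
    intro x hx
    have h1 : e.symm (e x) = x := e.left_inv (by rw [hsrc]; exact hx)
    have h2 := congrFun hF (e x)
    simpa [h1] using h2.symm
  let v : S3 := ⟨EuclideanSpace.single 0 1, by simp⟩
  obtain ⟨f, hf, hψf⟩ := hlift v
  obtain ⟨g, hg, hψg⟩ := hlift (-v)
  have hv : v ≠ -v := ne_neg_of_mem_unit_sphere ℝ v
  -- Projecting from `-v` sends `v` to the origin, so the overlap is a punctured 3-dimensional
  -- space. Its connectedness lets the two lifts be matched by a single constant.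
  have hconn : IsConnected ({v}ᶜ ∩ {-v}ᶜ : Set S3) := by
    have hw : ‖((-v : S3) : EuclideanSpace ℝ (Fin 4))‖ = 1 := norm_eq_of_mem_sphere (-v)
    let e := stereographic hw
    have hsrc : e.source = {-v}ᶜ := stereographic_source hw
    have htgt : e.target = Set.univ := stereographic_target hw
    have hev : e v = 0 := stereographic_neg_apply v
    have hcont : Continuous e.symm := by
      rw [← continuousOn_univ, ← htgt]
      exact e.continuousOn_symm
    have himg : ({v}ᶜ ∩ {-v}ᶜ : Set S3) = e.symm '' {0}ᶜ := by
      ext x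
      constructor
      · rintro ⟨hx, hx'⟩
        refine ⟨e x, fun h => hx ?_, e.left_inv (hsrc ▸ hx')⟩
        exact e.injOn (hsrc ▸ hx') (hsrc ▸ hv) (h.trans hev.symm)
      · rintro ⟨y, hy, rfl⟩
        have hy' : y ∈ e.target := htgt ▸ Set.mem_univ y
        refine ⟨fun h => hy ?_, hsrc ▸ e.map_target hy'⟩
        rw [← e.right_inv hy', Set.mem_singleton_iff.1 h]
        exact hev
    rw [himg]
    refine (isConnected_compl_singleton_of_one_lt_rank ?_ _).image _ hcont.continuousOn
    have : Fact (Module.finrank ℝ (EuclideanSpace ℝ (Fin 4)) = 3 + 1) := ⟨by simp⟩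
    have h3 := Submodule.finrank_orthogonal_span_singleton (𝕜 := ℝ) (n := 3)
      (v := ((-v : S3) : EuclideanSpace ℝ (Fin 4))) (by intro h; simp [h] at hw)
    rw [← Module.finrank_eq_rank, h3]
    norm_num
  obtain ⟨x₀, hx₀, hx₀'⟩ := hconn.nonempty
  -- adjust `g` by a constant so that it agrees with `f` on the intersection
  have hagree : ∀ x ∈ ({v}ᶜ ∩ {-v}ᶜ : Set S3), f x = g x + (f x₀ - g x₀) := by
    have : PreconnectedSpace ({v}ᶜ ∩ {-v}ᶜ : Set S3) :=
      Subtype.preconnectedSpace hconn.isPreconnected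
    have h := hcov.eq_of_comp_eq
      (g₁ := fun x : ({v}ᶜ ∩ {-v}ᶜ : Set S3) => f x)
      (g₂ := fun x : ({v}ᶜ ∩ {-v}ᶜ : Set S3) => g x + (f x₀ - g x₀))
      (continuousOn_iff_continuous_domRestrict.1 (hf.mono Set.inter_subset_left))
      ((continuousOn_iff_continuous_domRestrict.1 (hg.mono Set.inter_subset_right)).add
        continuous_const) ?_ ⟨x₀, hx₀, hx₀'⟩ (by simp)
    · exact fun x hx => congrFun h ⟨x, hx⟩
    · ext1 x
      simp only [Function.comp_apply, Circle.exp_add, Circle.exp_sub]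
      rw [← hψf x x.2.1, ← hψg x x.2.2, ← hψf x₀ hx₀, ← hψg x₀ hx₀', div_self', mul_one]
  classical
  let k : S3 → ℝ := fun x => if x = v then g v + (f x₀ - g x₀) else f x
  have hkf : ∀ x ≠ v, k x = f x := fun x hx => if_neg hx
  have hkg : ∀ x ≠ -v, k x = g x + (f x₀ - g x₀) := by
    intro x hx
    by_cases hxv : x = v
    · subst hxv; exact if_pos rfl
    · rw [hkf x hxv]; exact hagree x ⟨hxv, hx⟩
  refine ⟨⟨k, continuous_iff_continuousAt.2 fun x => ?_⟩, fun x => ?_⟩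
  · by_cases hxv : x = v
    · have hx : x ≠ -v := hxv ▸ hv
      have hn : ({-v}ᶜ : Set S3) ∈ nhds x := isOpen_compl_singleton.mem_nhds hx
      have hc : ContinuousAt (fun y => g y + (f x₀ - g x₀)) x :=
        (hg.continuousAt hn).add continuousAt_const
      refine hc.congr ?_
      filter_upwards [hn] with y hy using (hkg y hy).symm
    · have hn : ({v}ᶜ : Set S3) ∈ nhds x := isOpen_compl_singleton.mem_nhds hxv
      refine (hf.continuousAt hn).congr ?_
      filter_upwards [hn] with y hy using (hkf y hy).symm
  · change ψ x = Circle.exp (k x)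
    by_cases hxv : x = v
    · have hx : x ≠ -v := hxv ▸ hv
      rw [hkg x hx, Circle.exp_add, Circle.exp_sub, ← hψg x hx, ← hψf x₀ hx₀, ← hψg x₀ hx₀',
        div_self', mul_one]
    · rw [hkf x hxv, hψf x hxv]

end Lifting

/-! ### Extending circle-valued maps from the exterior to the 3-sphere -/

namespace TubularNeighborhood

variable {n : ℕ} {L : OrientedLink n} (N : TubularNeighborhood L)

lemma isClosed_exterior : IsClosed N.exterior :=
  (isOpen_iUnion fun i => (N.isOpenEmbedding i).isOpenMap _
    (isOpen_univ.prod Metric.isOpen_ball)).isClosed_compl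

lemma tube_notMem_exterior (i : Fin n) (z : Circle) (w : ℂ) (hw : ‖w‖ < 1) :
    N.tube i (z, w) ∉ N.exterior := fun h =>
  h (Set.mem_iUnion.2 ⟨i, (z, w), ⟨Set.mem_univ _, by simpa using hw⟩, rfl⟩)

/-- A map on the exterior extends over the `i`-th solid torus if it is null-homotopic on the
meridian. -/
lemma exists_extension_tube (ψ : C(N.exterior, Circle)) (i : Fin n)
    (hψ : (ψ.comp (N.meridian i)).Homotopic 1) :
    ∃ G : C(Circle × ℂ, Circle), ∀ z w (hw : ‖w‖ = 1),
      G (z, w) = ψ ⟨N.tube i (z, w), N.tube_mem_exterior i z w hw⟩ := by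
  obtain ⟨a, ha⟩ := exists_lift_of_homotopic_one hψ
  let g : C(Circle × Circle, Circle) :=
    ⟨fun p => ψ ⟨N.tube i (p.1, p.2), N.tube_mem_exterior i p.1 p.2 p.2.norm_coe⟩,
      ψ.continuous.comp (Continuous.subtype_mk
        ((N.isOpenEmbedding i).continuous.comp (by fun_prop)) _)⟩
  obtain ⟨b, hb⟩ := exists_lift_torus g a ha
  -- The real function `b` on the boundary torus extends by Tietze to `S¹ × ℂ`; the factor `g (z,
  -- 1)` extends as it does not involve `w`.
  have hemb : Topology.IsClosedEmbedding
      (Prod.map id (fun w : Circle => (w : ℂ)) : Circle × Circle → Circle × ℂ) := by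
    refine Topology.IsClosedEmbedding.id.prodMap ?_
    exact (show Continuous fun w : Circle => (w : ℂ) by fun_prop).isClosedEmbedding
      Circle.coe_injective
  obtain ⟨B, hB⟩ := ContinuousMap.exists_extension hemb b
  refine ⟨⟨fun p => g (p.1, 1) * Circle.exp (B p), by fun_prop⟩, fun z w hw => ?_⟩
  let w' : Circle := ⟨w, by simpa [Submonoid.unitSphere] using hw⟩
  have h1 : B (z, w) = b (z, w') := congrArg (fun k : C(_, ℝ) => k (z, w')) hB
  change g (z, 1) * Circle.exp (B (z, w)) = _
  rw [h1, ← hb]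
  rfl

/-- A map on the exterior that is null-homotopic on the meridians extends to the 3-sphere. -/
lemma exists_extension (ψ : C(N.exterior, Circle))
    (hψ : ∀ i, (ψ.comp (N.meridian i)).Homotopic 1) :
    ∃ ψ' : C(S3, Circle), ∀ x : N.exterior, ψ' x = ψ x := by
  choose G hG using fun i => N.exists_extension_tube ψ i (hψ i)
  have hout : ∀ x : S3, x ∉ N.exterior → ∃ q : Fin n × (Circle × ℂ), N.tube q.1 q.2 = x := by
    intro x hx
    simp only [exterior, Set.mem_compl_iff, not_not, Set.mem_iUnion] at hx
    obtain ⟨i, p, -, h⟩ := hx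
    exact ⟨(i, p), h⟩
  choose q hq using hout
  classical
  let F : S3 → Circle := fun x =>
    if h : x ∈ N.exterior then ψ ⟨x, h⟩ else G (q x h).1 (q x h).2
  have hFin : ∀ x : N.exterior, F x = ψ x := fun x => dif_pos x.2
  have hFtube : ∀ i z w, ‖w‖ ≤ 1 → F (N.tube i (z, w)) = G i (z, w) := by
    intro i z w hw
    rcases hw.lt_or_eq with hw | hw
    · have hx := N.tube_notMem_exterior i z w hw
      have h1 := hq _ hx
      have hi : (q _ hx).1 = i := by
        by_contra hne
        exact Set.disjoint_left.1 (N.disjoint hne) ⟨_, h1⟩ ⟨_, rfl⟩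
      have h2 : (q _ hx).2 = (z, w) := by
        apply (N.isOpenEmbedding i).injective
        rw [hi] at h1
        exact h1
      change dite _ _ _ = _
      rw [dif_neg hx, hi, h2]
    · rw [hG i z w hw]
      exact hFin ⟨_, N.tube_mem_exterior i z w hw⟩
  have hcont : Continuous F := by
    -- Finite closed cover by the exterior (`none`) and the closed solid tori. On their common
    -- boundary the two formulas for `F` agree.
    let S : Option (Fin n) → Set S3 := fun o => o.elim N.exterior
      fun i => N.tube i '' (Set.univ ×ˢ Metric.closedBall (0 : ℂ) 1)
    refine (locallyFinite_of_finite S).continuous ?_ ?_ ?_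
    · refine Set.eq_univ_of_forall fun x => Set.mem_iUnion.2 ?_
      by_cases hx : x ∈ N.exterior
      · exact ⟨none, hx⟩
      · simp only [exterior, Set.mem_compl_iff, not_not, Set.mem_iUnion] at hx
        obtain ⟨i, p, hp, h⟩ := hx
        exact ⟨some i, p, ⟨hp.1, Metric.ball_subset_closedBall hp.2⟩, h⟩
    · rintro (_ | i)
      · exact N.isClosed_exterior
      · exact ((isCompact_univ.prod (isCompact_closedBall _ _)).image
          (N.isOpenEmbedding i).continuous).isClosed
    · rintro (_ | i)
      · rw [continuousOn_iff_continuous_domRestrict]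
        exact ψ.continuous.congr fun x => (hFin x).symm
      · rintro _ ⟨⟨z, w⟩, hp, rfl⟩
        change ContinuousWithinAt F (N.tube i '' (Set.univ ×ˢ Metric.closedBall (0 : ℂ) 1)) _
        rw [ContinuousWithinAt, ← (N.isOpenEmbedding i).isInducing.map_nhdsWithin_eq,
          Filter.tendsto_map'_iff, hFtube i z w (by simpa using hp.2)]
        refine ((G i).continuous.continuousWithinAt (s := Set.univ ×ˢ Metric.closedBall 0 1)
          (x := (z, w))).congr' ?_
        filter_upwards [self_mem_nhdsWithin] with p hp
        exact (hFtube i p.1 p.2 (by simpa using hp.2)).symm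
  exact ⟨⟨F, hcont⟩, hFin⟩

/-- Two maps in the homotopy class given by the multiplicities differ by a map that lifts
to `ℝ`. -/
lemma exists_lift_of_mem_homotopyClass {m : Fin n → ℤ} {φ φ₀ : C(N.exterior, Circle)}
    (hφ : φ ∈ homotopyClass N m) (hφ₀ : φ₀ ∈ homotopyClass N m) :
    ∃ f : C(N.exterior, ℝ), ∀ x, φ x = φ₀ x * Circle.exp (f x) := by
  -- On each meridian both maps are homotopic to the same power map, so the quotient of the
  -- homotopies ends at the constant `1`.
  obtain ⟨ψ, hψ⟩ := N.exists_extension (φ / φ₀) fun i => by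
    obtain ⟨H⟩ := hφ i
    obtain ⟨H₀⟩ := hφ₀ i
    exact ⟨⟨⟨fun p => H p / H₀ p, by fun_prop⟩, fun x => by simp, fun x => by simp⟩⟩
  obtain ⟨f, hf⟩ := exists_lift_S3 ψ
  refine ⟨f.comp ⟨Subtype.val, continuous_subtype_val⟩, fun x => ?_⟩
  have : φ x / φ₀ x = Circle.exp (f x) := (hψ x).symm.trans (hf x)
  simp [← this]

end TubularNeighborhood


/-! ### Existence of a monodromy -/

section Monodromy

open Bundle

variable {X : Type} [TopologicalSpace X]

/-- The height function of the infinite cyclic covering. -/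
def CyclicCover.height (φ : C(X, Circle)) (p : CyclicCover φ) : ℝ := p.1.2

lemma CyclicCover.continuous_height (φ : C(X, Circle)) : Continuous (CyclicCover.height φ) :=
  continuous_snd.comp continuous_subtype_val

/-- The infinite cyclic covering of a locally trivial fibration is trivial over a closed
interval. -/
lemma exists_trivialization_height (φ : C(X, Circle)) {G : Type} [TopologicalSpace G] [Nonempty G]
    (hφ : ∀ b : Circle, ∃ e : Trivialization G (φ : X → Circle), b ∈ e.baseSet) (a b : ℝ) :
    ∃ e : Trivialization G (CyclicCover.height φ), Set.Icc a b ⊆ e.baseSet := by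
  -- The local trivializations are repackaged as a `FiberBundle` with total space homeomorphic to
  -- `X`; its pullback along `r ↦ exp (2πir)` is the cyclic covering, and a bundle over a closed
  -- interval is trivial.
  let E : Circle → Type := fun b => {x : X // φ x = b}
  let _ : ∀ b, TopologicalSpace (E b) := fun b =>
    inferInstanceAs (TopologicalSpace {x : X // φ x = b})
  let _ : TopologicalSpace (TotalSpace G E) := .induced (fun p => p.2.1) inferInstance
  have hE : ∀ b, Nonempty (E b) := fun b => by
    obtain ⟨e, he⟩ := hφ b
    obtain ⟨g⟩ := ‹Nonempty G›
    exact ⟨e.toOpenPartialHomeomorph.symm (b, g), e.proj_symm_apply' he⟩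
  let k : TotalSpace G E ≃ₜ X :=
    { toFun := fun p => p.2.1
      invFun := fun x => ⟨φ x, x, rfl⟩
      left_inv := by rintro ⟨b, x, rfl⟩; rfl
      right_inv := fun x => rfl
      continuous_toFun := continuous_induced_dom
      continuous_invFun := continuous_induced_rng.2 continuous_id }
  have hk : (φ : X → Circle) ∘ k = TotalSpace.proj := by
    ext1 p
    exact p.2.2
  choose e he using hφ
  let e' : Circle → Trivialization G (TotalSpace.proj : TotalSpace G E → Circle) :=
    fun b => hk ▸ (e b).compHomeomorph k
  have he' : ∀ b, b ∈ (e' b).baseSet := by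
    have : ∀ (p : TotalSpace G E → Circle) (hp : (φ : X → Circle) ∘ k = p) (b : Circle),
        b ∈ (hp ▸ (e b).compHomeomorph k : Trivialization G p).baseSet := by
      rintro _ rfl b
      exact he b
    exact this _ hk
  let _ : FiberBundle G E :=
    { totalSpaceMk_isInducing' := fun b => by
        constructor
        change instTopologicalSpaceSubtype = _
        rw [induced_compose]
        rfl
      trivializationAtlas' := Set.range e'
      trivializationAt' := e'
      mem_baseSet_trivializationAt' := he'
      trivialization_mem_atlas' := fun b => ⟨b, rfl⟩ }
  let f : C(ℝ, Circle) := ⟨fun r => Circle.exp (2 * Real.pi * r), by fun_prop⟩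
  obtain ⟨t, ht⟩ := FiberBundle.exists_trivialization_Icc_subset G ((f : ℝ → Circle) *ᵖ E) a b
  let c : CyclicCover φ ≃ₜ TotalSpace G ((f : ℝ → Circle) *ᵖ E) :=
    { toFun := fun p => ⟨p.1.2, ⟨p.1.1, p.2⟩⟩
      invFun := fun q => ⟨(q.2.1, q.1), q.2.2⟩
      left_inv := fun p => rfl
      right_inv := fun q => rfl
      continuous_toFun := by
        rw [(inducing_pullbackTotalSpaceEmbedding G E f).continuous_iff]
        refine Continuous.prodMk (CyclicCover.continuous_height φ) ?_
        exact continuous_induced_rng.2 (continuous_fst.comp continuous_subtype_val)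
      continuous_invFun := by
        refine Continuous.subtype_mk (Continuous.prodMk ?_ ?_) _
        · exact k.continuous.comp (Pullback.continuous_lift G E f)
        · exact Pullback.continuous_proj G E f }
  exact ⟨t.compHomeomorph c, ht⟩

/-- The slabs between consecutive integer heights form a locally finite closed cover. This serves
for maps defined through the floor of the height. -/
lemma continuous_of_continuousOn_height {Y Z : Type*} [TopologicalSpace Y] [TopologicalSpace Z]
    {u : Y → ℝ} (hu : Continuous u) {f : Y → Z}
    (hf : ∀ k : ℤ, ContinuousOn f (u ⁻¹' Set.Icc (k : ℝ) (k + 1))) : Continuous f := by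
  have hlf : LocallyFinite fun k : ℤ => Set.Icc (k : ℝ) (k + 1) := by
    intro x
    refine ⟨Set.Ioo (x - 1) (x + 1), Ioo_mem_nhds (by linarith) (by linarith), ?_⟩
    refine (Set.finite_Icc (⌊x⌋ - 2) (⌊x⌋ + 2)).subset ?_
    rintro k ⟨y, hy, hy'⟩
    have h1 := Int.floor_le x
    have h2 := Int.lt_floor_add_one x
    simp only [Set.mem_Icc, Set.mem_Ioo] at hy hy'
    constructor
    · have : ((⌊x⌋ - 2 : ℤ) : ℝ) < k + 1 := by push_cast; linarith
      have : ⌊x⌋ - 2 < k + 1 := by exact_mod_cast this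
      omega
    · have : (k : ℝ) < ((⌊x⌋ + 2 : ℤ) : ℝ) := by push_cast; linarith
      have : k < ⌊x⌋ + 2 := by exact_mod_cast this
      omega
  refine (hlf.preimage_continuous hu).continuous ?_ (fun k => isClosed_Icc.preimage hu) hf
  refine Set.eq_univ_of_forall fun y => Set.mem_iUnion.2 ⟨⌊u y⌋, Int.floor_le _, ?_⟩
  exact (Int.lt_floor_add_one _).le

lemma continuous_fiberInclusion (φ : C(X, Circle)) : Continuous (fiberInclusion φ) :=
  Continuous.subtype_mk (by fun_prop) _

/-- The deck transformations shift the height. -/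
lemma height_deckGenerator_zpow (φ : C(X, Circle)) (k : ℤ) (y : CyclicCover φ) :
    CyclicCover.height φ ((deckGenerator φ ^ k) y) = CyclicCover.height φ y + k := by
  induction k generalizing y with
  | zero => simp
  | succ k ih =>
    rw [zpow_add_one, Homeomorph.mul_apply, ih]
    change CyclicCover.height φ y + 1 + _ = _
    push_cast; ring
  | pred k ih =>
    rw [zpow_sub_one, Homeomorph.mul_apply, ih]
    change CyclicCover.height φ y - 1 + _ = _
    push_cast; ring

/-- A product structure over `[0, 1]` extends equivariantly to a product structure of the infinite
cyclic covering. -/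
lemma exists_isMonodromy_of_trivialization (φ : C(X, Circle)) {G : Type} [TopologicalSpace G]
    (e : Trivialization G (CyclicCover.height φ)) (he : Set.Icc 0 1 ⊆ e.baseSet) :
    ∃ h : fiber φ ≃ₜ fiber φ, IsMonodromy φ h := by
  let ht := CyclicCover.height φ
  let ι := fiberInclusion φ
  let D := deckGenerator φ
  have hht : Continuous ht := CyclicCover.continuous_height φ
  have hι : Continuous ι := continuous_fiberInclusion φ
  have hD : ∀ y, ht (D y) = ht y + 1 := fun y => rfl
  have hD' : ∀ y, ht (D.symm y) = ht y - 1 := fun y => rfl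
  have h0 : (0 : ℝ) ∈ e.baseSet := he ⟨le_rfl, zero_le_one⟩
  have hιht : ∀ x, ht (ι x) = 0 := fun x => rfl
  have hsource : ∀ y, ht y ∈ Set.Icc (0 : ℝ) 1 → y ∈ e.source := fun y hy =>
    e.mem_source.2 (he hy)
  have hsymm : ∀ (r : Set.Icc (0 : ℝ) 1) g, ht (e.toOpenPartialHomeomorph.symm ((r : ℝ), g)) = r :=
    fun r g => e.proj_symm_apply' (he r.2)
  -- the product structure over `[0, 1]`
  let cl : ℝ → Set.Icc (0 : ℝ) 1 := Set.projIcc 0 1 zero_le_one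
  have hcl : ∀ r (hr : r ∈ Set.Icc (0 : ℝ) 1), (cl r : ℝ) = r := fun r hr =>
    congrArg Subtype.val (Set.projIcc_of_mem zero_le_one hr)
  let A : fiber φ × ℝ → CyclicCover φ := fun p =>
    e.toOpenPartialHomeomorph.symm ((cl p.2 : ℝ), (e (ι p.1)).2)
  have hAht : ∀ x r, ht (A (x, r)) = cl r := fun x r => hsymm _ _
  have hA0 : ∀ x, A (x, 0) = ι x := by
    intro x
    change e.toOpenPartialHomeomorph.symm ((cl 0 : ℝ), (e (ι x)).2) = _
    rw [hcl 0 ⟨le_rfl, zero_le_one⟩]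
    exact e.symm_apply_mk_proj (hsource (ι x) (by simp [hιht]))
  have hAcont : Continuous A := by
    refine e.toOpenPartialHomeomorph.continuousOn_symm.comp_continuous ?_ fun p => ?_
    · refine (continuous_subtype_val.comp (continuous_projIcc.comp continuous_snd)).prodMk ?_
      refine continuous_snd.comp
        (e.toOpenPartialHomeomorph.continuousOn.comp_continuous (hι.comp continuous_fst) ?_)
      exact fun p => hsource _ (by simp [hιht])
    · exact e.mem_target.2 (he (cl p.2).2)
  let B : CyclicCover φ → fiber φ := fun y =>
    ⟨(e.toOpenPartialHomeomorph.symm (0, (e y).2)).1.1, by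
      have h1 := (e.toOpenPartialHomeomorph.symm ((0 : ℝ), (e y).2)).2
      have h2 : (e.toOpenPartialHomeomorph.symm ((0 : ℝ), (e y).2)).1.2 = 0 :=
        e.proj_symm_apply' h0
      rw [h1, h2]; simp⟩
  have hιB : ∀ y, ι (B y) = e.toOpenPartialHomeomorph.symm (0, (e y).2) := by
    intro y
    have h2 : (e.toOpenPartialHomeomorph.symm ((0 : ℝ), (e y).2)).1.2 = 0 :=
      e.proj_symm_apply' h0
    exact Subtype.ext (Prod.ext rfl h2.symm)
  have hBcont : ContinuousOn B (ht ⁻¹' Set.Icc 0 1) := by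
    refine Topology.IsInducing.subtypeVal.continuousOn_iff.2 ?_
    have h1 : ContinuousOn (fun y => e.toOpenPartialHomeomorph.symm ((0 : ℝ), (e y).2))
        (ht ⁻¹' Set.Icc 0 1) := by
      refine e.toOpenPartialHomeomorph.continuousOn_symm.comp ?_ fun y _ => e.mem_target.2 h0
      refine continuousOn_const.prodMk (continuous_snd.comp_continuousOn ?_)
      exact e.toOpenPartialHomeomorph.continuousOn.mono fun y hy => hsource y hy
    exact (continuous_fst.comp continuous_subtype_val).comp_continuousOn h1
  have hBA : ∀ x r, B (A (x, r)) = x := by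
    intro x r
    have hinj : Function.Injective ι := fun x y h =>
      Subtype.ext (congrArg (fun p : CyclicCover φ => p.1.1) h)
    apply hinj
    rw [hιB, ← hA0]
    change e.toOpenPartialHomeomorph.symm
      (0, (e (e.toOpenPartialHomeomorph.symm ((cl r : ℝ), (e (ι x)).2))).2) = _
    rw [e.apply_symm_apply' (he (cl r).2)]
    change _ = e.toOpenPartialHomeomorph.symm ((cl 0 : ℝ), (e (ι x)).2)
    rw [hcl 0 ⟨le_rfl, zero_le_one⟩]
  have hBι : ∀ x, B (ι x) = x := fun x => by rw [← hA0, hBA]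
  have hAB : ∀ y, ht y ∈ Set.Icc (0 : ℝ) 1 → A (B y, ht y) = y := by
    intro y hy
    change e.toOpenPartialHomeomorph.symm ((cl (ht y) : ℝ), (e (ι (B y))).2) = _
    rw [hιB, e.apply_symm_apply' h0, hcl _ hy]
    exact e.symm_apply_mk_proj (hsource y hy)
  have hιB0 : ∀ y, ht y = 0 → ι (B y) = y := by
    intro y hy
    rw [← hA0, ← hy]
    exact hAB y (by simp [hy])
  -- the monodromy
  have hcl1 : (cl 1 : ℝ) = 1 := hcl 1 ⟨zero_le_one, le_rfl⟩
  -- The monodromy compares two identifications of the fiber with the slice at height one, by deck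
  -- translation and by the product structure: `A (h x, 1) = D (ι x)`.
  let h : fiber φ ≃ₜ fiber φ :=
    { toFun := fun x => B (D (ι x))
      invFun := fun x => B (D.symm (A (x, 1)))
      left_inv := fun x => by
        have h1 : ht (D (ι x)) = 1 := by rw [hD, hιht, zero_add]
        have h2 := hAB (D (ι x)) (by simp [h1])
        rw [h1] at h2
        change B (D.symm (A (B (D (ι x)), 1))) = x
        rw [h2, Homeomorph.symm_apply_apply, hBι]
      right_inv := fun x => by
        change B (D (ι (B (D.symm (A (x, 1)))))) = x
        rw [hιB0 _ (by rw [hD', hAht, hcl1, sub_self]), Homeomorph.apply_symm_apply, hBA]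
      continuous_toFun := hBcont.comp_continuous (D.continuous.comp hι) fun x => by
        simp [hD, hιht]
      continuous_invFun := hBcont.comp_continuous
        (D.symm.continuous.comp (hAcont.comp (by fun_prop))) fun x => by
        simp [hD', hAht, hcl1] }
  have hAh : ∀ x, A (h x, 1) = D (ι x) := by
    intro x
    have h1 : ht (D (ι x)) = 1 := by rw [hD, hιht, zero_add]
    have h2 := hAB (D (ι x)) (by simp [h1])
    rwa [h1] at h2
  have hfloor : ∀ z : ℝ, z - ⌊z⌋ ∈ Set.Icc (0 : ℝ) 1 := fun z =>
    ⟨Int.fract_nonneg z, (Int.fract_lt_one z).le⟩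
  have hcase : ∀ (k : ℤ) (z : ℝ), z ∈ Set.Icc (k : ℝ) (k + 1) →
      ⌊z⌋ = k ∨ (⌊z⌋ = k + 1 ∧ z = k + 1) := by
    intro k z hz
    rcases hz.2.lt_or_eq with hz' | hz'
    · exact .inl (Int.floor_eq_iff.2 ⟨hz.1, hz'⟩)
    · exact .inr ⟨by rw [hz']; simp, hz'⟩
  let Ψ : fiber φ × ℝ → CyclicCover φ := fun p =>
    (D ^ ⌊p.2⌋) (A ((h ^ (-⌊p.2⌋)) p.1, p.2 - ⌊p.2⌋))
  let Φ : CyclicCover φ → fiber φ × ℝ := fun y =>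
    ((h ^ ⌊ht y⌋) (B ((D ^ (-⌊ht y⌋)) y)), ht y)
  have hDht : ∀ (k : ℤ) y, ht ((D ^ k) y) = ht y + k := height_deckGenerator_zpow φ
  -- The formula for slab `k` persists at its top `z = k + 1`, where the floor jumps: there `A (h x,
  -- 1) = D (ι x)` identifies it with the formula for the next slab. This is what makes `Ψ`
  -- continuous.
  have hΨ : ∀ (k : ℤ) x z, z ∈ Set.Icc (k : ℝ) (k + 1) →
      Ψ (x, z) = (D ^ k) (A ((h ^ (-k)) x, z - k)) := by
    intro k x z hz
    rcases hcase k z hz with h1 | ⟨h1, h2⟩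
    · simp only [Ψ, h1]
    · simp only [Ψ, h1]
      subst h2
      have h3 : (h ^ (-k)) x = h ((h ^ (-(k + 1))) x) := by
        rw [← Homeomorph.mul_apply, ← zpow_one_add]; congr 2; ring
      rw [zpow_add_one, Homeomorph.mul_apply, h3, add_sub_cancel_left, hAh]
      push_cast
      rw [sub_self, hA0]
  have hΦ : ∀ (k : ℤ) y, ht y ∈ Set.Icc (k : ℝ) (k + 1) →
      Φ y = ((h ^ k) (B ((D ^ (-k)) y)), ht y) := by
    intro k y hy
    rcases hcase k (ht y) hy with h1 | ⟨h1, h2⟩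
    · simp only [Φ, h1]
    · simp only [Φ, h1]
      have h3 : (D ^ (-k)) y = D ((D ^ (-(k + 1))) y) := by
        rw [← Homeomorph.mul_apply, ← zpow_one_add]; congr 2; ring
      have h4 : ht ((D ^ (-(k + 1))) y) = 0 := by
        rw [hDht, h2]; push_cast; ring
      rw [h3, zpow_add_one, Homeomorph.mul_apply, ← hιB0 _ h4, hBι]
      rfl
  have hΨht : ∀ x z, ht (Ψ (x, z)) = z := by
    intro x z
    rw [hDht, hAht, hcl _ (hfloor z)]
    simp
  have hΦΨ : ∀ p, Φ (Ψ p) = p := by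
    rintro ⟨x, z⟩
    simp only [Φ, hΨht]
    simp only [Ψ]
    rw [← Homeomorph.mul_apply (D ^ _), ← zpow_add, neg_add_cancel, zpow_zero, Homeomorph.one_apply,
      hBA, ← Homeomorph.mul_apply, ← zpow_add, add_neg_cancel, zpow_zero, Homeomorph.one_apply]
  have hΨΦ : ∀ y, Ψ (Φ y) = y := by
    intro y
    simp only [Ψ, Φ]
    rw [← Homeomorph.mul_apply (h ^ _), ← zpow_add, neg_add_cancel, zpow_zero,
      Homeomorph.one_apply]
    have h1 : ht y - ⌊ht y⌋ = ht ((D ^ (-⌊ht y⌋)) y) := by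
      rw [hDht]; push_cast; ring
    rw [h1, hAB _ (h1 ▸ hfloor (ht y)), ← Homeomorph.mul_apply, ← zpow_add, add_neg_cancel,
      zpow_zero, Homeomorph.one_apply]
  have hΨcont : Continuous Ψ := by
    refine continuous_of_continuousOn_height continuous_snd fun k => ?_
    have h1 : Continuous fun p : fiber φ × ℝ => (D ^ k) (A ((h ^ (-k)) p.1, p.2 - k)) := by
      fun_prop
    exact h1.continuousOn.congr fun p hp => hΨ k p.1 p.2 hp
  have hΦcont : Continuous Φ := by
    refine continuous_of_continuousOn_height hht fun k => ?_
    have h1 : ContinuousOn (fun y => B ((D ^ (-k)) y)) (ht ⁻¹' Set.Icc (k : ℝ) (k + 1)) := by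
      refine hBcont.comp (D ^ (-k)).continuous.continuousOn fun y hy => ?_
      have h2 := hDht (-k) y
      push_cast at h2
      exact ⟨by rw [h2]; linarith [hy.1], by rw [h2]; linarith [hy.2]⟩
    exact (((h ^ k).continuous.comp_continuousOn h1).prodMk hht.continuousOn).congr
      fun y hy => hΦ k y hy
  refine ⟨h, ⟨⟨Ψ, Φ, hΦΨ, hΨΦ⟩, hΨcont, hΦcont⟩, hΨht, fun x => ?_, fun x z => ?_⟩
  · change Ψ (x, 0) = ι x
    rw [hΨ 0 x 0 (by simp), neg_zero, zpow_zero, zpow_zero, Int.cast_zero, sub_zero,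
      Homeomorph.one_apply, Homeomorph.one_apply, hA0]
  · change D (Ψ (x, z)) = Ψ (h x, z + 1)
    simp only [Ψ, Int.floor_add_one]
    have h1 : (h ^ (-(⌊z⌋ + 1))) (h x) = (h ^ (-⌊z⌋)) x := by
      rw [← Homeomorph.mul_apply, ← zpow_add_one]; congr 2; ring
    rw [h1, ← Homeomorph.mul_apply, ← zpow_one_add, add_comm 1]
    push_cast
    rw [add_sub_add_right_eq_sub]

theorem IsLocallyTrivialFibration.exists_isMonodromy {φ : C(X, Circle)}
    (hφ : IsLocallyTrivialFibration φ) : ∃ h : fiber φ ≃ₜ fiber φ, IsMonodromy φ h := by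
  obtain ⟨G, _, hG⟩ := hφ
  -- With an empty model fiber `X` and its covering are empty and the identity is a monodromy;
  -- otherwise the bundle argument applies.
  rcases isEmpty_or_nonempty G with hempty | hne
  · have hX : IsEmpty X := ⟨fun x => by
      obtain ⟨e, -⟩ := hG (φ x)
      exact hempty.elim (e x).2⟩
    have hC : IsEmpty (CyclicCover φ) := ⟨fun p => hX.elim p.1.1⟩
    refine ⟨Homeomorph.refl _, Homeomorph.empty, fun x => hX.elim x.1, fun x => hX.elim x.1,
      fun x => hX.elim x.1⟩
  · obtain ⟨e, he⟩ := exists_trivialization_height φ hG 0 1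
    exact exists_isMonodromy_of_trivialization φ e he

end Monodromy

end

theorem mainTheorem5 {n : ℕ} (L : Multilink n) (N : TubularNeighborhood L.toOrientedLink)
    (φ : C(N.exterior, Circle)) (hφ : φ ∈ homotopyClass N L.mult)
    (hfib : IsLocallyTrivialFibration φ)
    (φ₀ : C(N.exterior, Circle)) (hφ₀ : φ₀ ∈ homotopyClass N L.mult) :
    (∃ h : fiber φ ≃ₜ fiber φ, IsMonodromy φ h) ∧
    ∀ h : fiber φ ≃ₜ fiber φ, IsMonodromy φ h →
      ∀ (μ : ℕ) (b : Module.Basis (Fin μ) ℤ (H1 (fiber φ))) (H : Matrix (Fin μ) (Fin μ) ℤ),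
        H = LinearMap.toMatrix b b (H1.aut h).toLinearMap →
        IsPresentationMatrix
          (H.transpose.map (LaurentPolynomial.C : ℤ →+* LaurentPolynomial ℤ)
            - (LaurentPolynomial.T 1 : LaurentPolynomial ℤ) • 1)
          (AlexanderModule φ₀) ∧
        IsAlexanderPolynomial (AlexanderModule φ₀) (Polynomial.toLaurent H.charpoly) := by
  refine ⟨hfib.exists_isMonodromy, ?_⟩
  rintro h hh μ b H rfl
  obtain ⟨f, hf⟩ := N.exists_lift_of_mem_homotopyClass hφ hφ₀
  obtain ⟨ε⟩ := hh.nonempty_linearEquiv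
  obtain ⟨ε₀⟩ := nonempty_alexanderModule_equiv f hf
  -- The presentation passes from `H₁(F)` to the module of `φ` by `ε`, then to that of `φ₀` by `ε₀`.
  have hP := (isPresentationMatrix_transpose_sub_T b (H1.aut h)).congr (ε.trans ε₀)
  exact ⟨hP, hP.isAlexanderPolynomial (associated_det_charpoly _)⟩
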